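/- Call a family of sets $S_1,\dots,S_k$ a *$k$-moonflower* if there is a set $I$ such that the sets $S_1\setminus I,\dots,S_k\setminus I$ are all nonempty and pairwise disjoint (equivalently, each $S_i$ contains an element that lies in none of the other $S_j$). A family $\mathcal F$ of sets is *$k$-moonflower-free* if no $k$ of its members form a $k$-moonflower. There exists an absolute constant $C>0$ such that the following holds. Let $k,w\ge 1$ be integers and let $\mathcal F$ be a finite $k$-moonflower-free family of finite sets, each of size at most $w$. Then $$|\mathcal F|\le\begin{cases}\left(C\cdot\frac{k}{w}\right)^{w} & \text{if } w\le k,\\[4pt] \left(C\cdot\frac{w}{k}\right)^{k} & \text{if } w\ge k.\end{cases}$$ In particular, if $w=\Theta(k)$ then $|\mathcal F|\le\exp(O(w))$: for every $A>0$ there is a constant $c>0$, depending only on $A$, such that $|\mathcal F|\le e^{cw}$ for all such $k,w,\mathcal F$ with $w\le Ak$ and $k\le Aw$. -/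

import Mathlib

universe u

/-- The sets `S₁, …, S_k` form a `k`-moonflower: for some set `I`, the sets `S_i \ I` are all
nonempty and pairwise disjoint. -/
def IsMoonflower {α : Type*} [DecidableEq α] {k : ℕ} (S : Fin k → Finset α) : Prop :=
  ∃ I : Finset α, (∀ i, (S i \ I).Nonempty) ∧ ∀ i j, i ≠ j → Disjoint (S i \ I) (S j \ I)

/-- A family of sets is `k`-moonflower-free if no `k` of its members form a `k`-moonflower. (The
members of a moonflower are automatically distinct.) -/
def MoonflowerFree {α : Type*} [DecidableEq α] (k : ℕ) (F : Finset (Finset α)) : Prop :=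
  ∀ S : Fin k → Finset α, (∀ i, S i ∈ F) → ¬ IsMoonflower S

/-- A family of `w`-sets, that is, of sets of size at most `w`. -/
def IsFamilyOfWSets {α : Type*} (w : ℕ) (F : Finset (Finset α)) : Prop :=
  ∀ S ∈ F, S.card ≤ w

/-!
A minimal set `T` meeting every `R \ S`, for the members `R ⊈ S` of a moonflower-free family,
has fewer than `k` elements: each `t ∈ T` has its own `R`, with `R ∩ T = {t}`, and these sets
form a moonflower. Call it `T S`. Of two distinct members, one is not contained in the other, so
`R` meets `T S` or `S` meets `T R`. Hence, for a random set `X` containing each point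
independently with probability `p`, the events `S ⊆ X ⊆ (T S)ᶜ` are mutually exclusive (Tuza's
set-pair inequality). Each has probability at least `p ^ w * (1 - p) ^ k`, and `p = w / (w + k)`
gives the bound.
-/

section SetPairs

open Finset

variable {α R : Type*}

theorem sum_Icc_pow_card_mul_pow_card [DecidableEq α] [CommSemiring R] {p q : R}
    (hpq : p + q = 1) {A B U : Finset α} (hAB : Disjoint A B) (hAU : A ⊆ U) (hBU : B ⊆ U) :
    ∑ X ∈ Icc A (U \ B), p ^ #X * q ^ #(U \ X) = p ^ #A * q ^ #B := by
  have hA : A ⊆ U \ B := subset_sdiff.2 ⟨hAU, hAB⟩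
  have hinj : Set.InjOn (A ∪ ·) ((U \ B) \ A).powerset := fun Y hY Z hZ h => by
    rw [← union_sdiff_cancel_left (disjoint_sdiff.mono_right (mem_powerset.1 hY)),
      show A ∪ Y = A ∪ Z from h,
      union_sdiff_cancel_left (disjoint_sdiff.mono_right (mem_powerset.1 hZ))]
  have hweight : ∀ Y ∈ ((U \ B) \ A).powerset, p ^ #(A ∪ Y) * q ^ #(U \ (A ∪ Y)) =
      p ^ #A * q ^ #B * (p ^ #Y * q ^ (#((U \ B) \ A) - #Y)) := fun Y hY => by
    have hY := mem_powerset.1 hY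
    have hAY : Disjoint A Y := disjoint_sdiff.mono_right hY
    have hcompl : U \ (A ∪ Y) = B ∪ (((U \ B) \ A) \ Y) := by
      grind [Finset.disjoint_left]
    have hB : Disjoint B (((U \ B) \ A) \ Y) :=
      disjoint_sdiff.mono_right (sdiff_subset.trans sdiff_subset)
    rw [hcompl, card_union_of_disjoint hAY, card_union_of_disjoint hB, card_sdiff_of_subset hY]
    ring
  rw [Icc_eq_image_powerset hA, sum_image hinj, sum_congr rfl hweight, ← mul_sum,
    sum_pow_mul_eq_add_pow, hpq, one_pow, mul_one]

theorem sum_pow_card_mul_pow_card_le_one [CommSemiring R] [PartialOrder R] [IsOrderedRing R]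
    {p q : R} (hp : 0 ≤ p) (hq : 0 ≤ q) (hpq : p + q = 1) {ι : Type*} (s : Finset ι)
    {A B : ι → Finset α} (hdisj : ∀ i ∈ s, Disjoint (A i) (B i))
    (hcross : (s : Set ι).Pairwise fun i j => ¬ Disjoint (A i) (B j) ∨ ¬ Disjoint (A j) (B i)) :
    ∑ i ∈ s, p ^ #(A i) * q ^ #(B i) ≤ 1 := by
  classical
  set U := s.biUnion fun i => A i ∪ B i
  have hU : ∀ i ∈ s, A i ∪ B i ⊆ U := fun i hi => subset_biUnion_of_mem (fun i => A i ∪ B i) hi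
  have hIcc : (s : Set ι).PairwiseDisjoint fun i => Icc (A i) (U \ B i) := by
    refine fun i hi j hj hij => disjoint_left.2 fun X hXi hXj => ?_
    obtain ⟨hAi, hBi⟩ := mem_Icc.1 hXi
    obtain ⟨hAj, hBj⟩ := mem_Icc.1 hXj
    rcases hcross hi hj hij with h | h
    · exact h (disjoint_sdiff_self_left.mono_left (hAi.trans hBj))
    · exact h (disjoint_sdiff_self_left.mono_left (hAj.trans hBi))
  calc ∑ i ∈ s, p ^ #(A i) * q ^ #(B i)
      = ∑ i ∈ s, ∑ X ∈ Icc (A i) (U \ B i), p ^ #X * q ^ #(U \ X) :=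
        sum_congr rfl fun i hi => (sum_Icc_pow_card_mul_pow_card hpq (hdisj i hi)
          (subset_union_left.trans (hU i hi)) (subset_union_right.trans (hU i hi))).symm
    _ = ∑ X ∈ s.biUnion fun i => Icc (A i) (U \ B i), p ^ #X * q ^ #(U \ X) :=
        (sum_biUnion hIcc).symm
    _ ≤ ∑ X ∈ Icc ∅ (U \ ∅), p ^ #X * q ^ #(U \ X) :=
        sum_le_sum_of_subset_of_nonneg
          (biUnion_subset.2 fun i _ => Icc_subset_Icc (empty_subset _)
            (sdiff_subset_sdiff subset_rfl (empty_subset _)))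
          fun X _ _ => by positivity
    _ = 1 := by
        simpa using sum_Icc_pow_card_mul_pow_card hpq (disjoint_empty_left ∅)
          (empty_subset U) (empty_subset U)

end SetPairs

section Moonflower

open Finset

variable {α : Type*} [DecidableEq α] {k w : ℕ} {F : Finset (Finset α)}

theorem exists_transversal_forall_inter_eq_singleton {ι : Type*} {s : Finset ι}
    {R : ι → Finset α} (hR : ∀ i ∈ s, (R i).Nonempty) :
    ∃ T : Finset α, (∀ i ∈ s, ¬ Disjoint (R i) T) ∧ ∀ t ∈ T, ∃ i ∈ s, R i ∩ T = {t} := by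
  have hunion : ∀ i ∈ s, ¬ Disjoint (R i) (s.biUnion R) := fun i hi h =>
    (hR i hi).ne_empty (disjoint_self_iff_empty _ |>.1 (h.mono_right (subset_biUnion_of_mem R hi)))
  obtain ⟨T, -, hT⟩ :=
    exists_minimal_le_of_wellFoundedLT (fun T => ∀ i ∈ s, ¬ Disjoint (R i) T) _ hunion
  refine ⟨T, hT.prop, fun t ht => ?_⟩
  have herase : ¬ ∀ i ∈ s, ¬ Disjoint (R i) (T.erase t) := fun h =>
    notMem_erase t T (hT.le_of_le h (erase_subset t T) ht)
  push Not at herase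
  obtain ⟨i, hi, hit⟩ := herase
  have hsub : R i ∩ T ⊆ {t} := by grind [Finset.disjoint_left]
  exact ⟨i, hi, (subset_singleton_iff.1 hsub).resolve_left
    (mt disjoint_iff_inter_eq_empty.2 (hT.prop i hi))⟩

theorem isMoonflower_of_mem_iff_eq {S : Fin k → Finset α} {x : Fin k → α}
    (hx : ∀ i j, x i ∈ S j ↔ i = j) : IsMoonflower S := by
  have hpetal : ∀ i, S i \ (univ.biUnion S \ univ.image x) = {x i} := by
    intro i
    ext y
    simp only [mem_sdiff, mem_biUnion, mem_image, mem_univ, true_and, mem_singleton]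
    grind
  refine ⟨univ.biUnion S \ univ.image x, fun i => ?_, fun i j hij => ?_⟩
  · rw [hpetal]
    exact singleton_nonempty _
  · rw [hpetal, hpetal, disjoint_singleton]
    exact fun h => hij ((hx i j).1 (h ▸ (hx j j).2 rfl))

namespace MoonflowerFree

theorem pos (hF : MoonflowerFree k F) : 0 < k := by
  rw [Nat.pos_iff_ne_zero]
  rintro rfl
  exact hF Fin.elim0 (fun i => i.elim0) ⟨∅, fun i => i.elim0, fun i => i.elim0⟩

theorem card_lt_of_forall_inter_eq_singleton (hF : MoonflowerFree k F) {T : Finset α}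
    (hT : ∀ t ∈ T, ∃ R ∈ F, R ∩ T = {t}) : #T < k := by
  by_contra! hk
  obtain ⟨x⟩ : Nonempty (Fin k ↪ T) := Function.Embedding.nonempty_of_card_le (by simpa using hk)
  choose R hRF hR using fun t : T => hT t t.2
  refine hF (fun i => R (x i)) (fun i => hRF _)
    (isMoonflower_of_mem_iff_eq (x := fun i => x i) fun i j => ?_)
  rw [← x.injective.eq_iff, Subtype.ext_iff, ← mem_singleton, ← hR, mem_inter,
    and_iff_left (x i).2]

theorem exists_transversal (hF : MoonflowerFree k F) (S : Finset α) :
    ∃ T : Finset α, #T < k ∧ Disjoint S T ∧ ∀ R ∈ F, ¬ R ⊆ S → ¬ Disjoint R T := by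
  obtain ⟨T, hmeet, hprivate⟩ :=
    exists_transversal_forall_inter_eq_singleton (s := {R ∈ F | ¬ R ⊆ S}) (R := (· \ S))
      fun R hR => sdiff_nonempty.2 (mem_filter.1 hR).2
  have hST : Disjoint S T := disjoint_right.2 fun t ht => by
    obtain ⟨R, -, hRt⟩ := hprivate t ht
    have htR : t ∈ (R \ S) ∩ T := hRt ▸ mem_singleton_self t
    exact (mem_sdiff.1 (mem_inter.1 htR).1).2
  refine ⟨T, hF.card_lt_of_forall_inter_eq_singleton fun t ht => ?_, hST, fun R hR hRS h =>
    hmeet R (mem_filter.2 ⟨hR, hRS⟩) (h.mono_left sdiff_subset)⟩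
  obtain ⟨R, hR, hRt⟩ := hprivate t ht
  refine ⟨R, (mem_filter.1 hR).1, ?_⟩
  rw [← hRt, sdiff_inter_right_comm, inter_sdiff_assoc, hST.symm.sdiff_eq_left]

theorem card_mul_pow_mul_pow_le_one (hF : MoonflowerFree k F) (hFw : IsFamilyOfWSets w F)
    {R : Type*} [CommSemiring R] [PartialOrder R] [IsOrderedRing R]
    {p q : R} (hp : 0 ≤ p) (hq : 0 ≤ q) (hpq : p + q = 1) :
    #F * (p ^ w * q ^ k) ≤ 1 := by
  choose T hTk hdisj hmeet using hF.exists_transversal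
  have hcross : (F : Set (Finset α)).Pairwise fun S S' =>
      ¬ Disjoint S (T S') ∨ ¬ Disjoint S' (T S) := fun S hS S' hS' hne => by
    by_cases h : S ⊆ S'
    · exact Or.inr (hmeet S S' hS' fun h' => hne (h.antisymm h'))
    · exact Or.inl (hmeet S' S hS h)
  have hp1 : p ≤ 1 := hpq ▸ le_add_of_nonneg_right hq
  have hq1 : q ≤ 1 := hpq ▸ le_add_of_nonneg_left hp
  calc #F * (p ^ w * q ^ k) = ∑ _ ∈ F, p ^ w * q ^ k := by rw [sum_const, nsmul_eq_mul]
    _ ≤ ∑ S ∈ F, p ^ #S * q ^ #(T S) := by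
        refine sum_le_sum fun S hS => mul_le_mul ?_ ?_ (pow_nonneg hq k) (pow_nonneg hp _)
        · exact pow_le_pow_of_le_one hp hp1 (hFw S hS)
        · exact pow_le_pow_of_le_one hq hq1 (hTk S).le
    _ ≤ 1 := sum_pow_card_mul_pow_card_le_one hp hq hpq F (fun S _ => hdisj S) hcross

theorem card_le_one_add_div_pow_mul (hF : MoonflowerFree k F) (hFw : IsFamilyOfWSets w F)
    (hw : 1 ≤ w) : (#F : ℝ) ≤ (1 + (k : ℝ) / w) ^ w * (1 + (w : ℝ) / k) ^ k := by
  have hk : (0 : ℝ) < k := by exact_mod_cast hF.pos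
  have : (0 : ℝ) < w := by exact_mod_cast hw
  have h := hF.card_mul_pow_mul_pow_le_one hFw (p := (1 + (k : ℝ) / w)⁻¹)
    (q := (1 + (w : ℝ) / k)⁻¹) (by positivity) (by positivity) (by field_simp; ring)
  rwa [inv_pow, inv_pow, ← mul_inv, ← div_eq_mul_inv, div_le_one (by positivity)] at h

end MoonflowerFree

end Moonflower

section Estimates

theorem one_add_div_pow_le_exp {x : ℝ} {n : ℕ} (hx : -x ≤ n) : (1 + x / n) ^ n ≤ Real.exp x := by
  simpa only [neg_div, sub_neg_eq_add, neg_neg] using Real.one_sub_div_pow_le_exp_neg hx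

theorem one_add_div_pow_mul_one_add_div_pow_le {m n : ℕ} (hm : 1 ≤ m) (hmn : m ≤ n) :
    (1 + (n : ℝ) / m) ^ m * (1 + (m : ℝ) / n) ^ n ≤ (2 * Real.exp 1 * ((n : ℝ) / m)) ^ m := by
  have hone : 1 ≤ (n : ℝ) / m := (one_le_div (by positivity)).2 (by exact_mod_cast hmn)
  calc (1 + (n : ℝ) / m) ^ m * (1 + (m : ℝ) / n) ^ n
      ≤ (2 * ((n : ℝ) / m)) ^ m * Real.exp m := by
        gcongr
        · linarith
        · exact one_add_div_pow_le_exp ((neg_nonpos.2 m.cast_nonneg).trans n.cast_nonneg)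
    _ = (2 * Real.exp 1 * ((n : ℝ) / m)) ^ m := by
        rw [← Real.exp_one_pow]
        ring

end Estimates

theorem theorem1p3_general {α : Type*} [DecidableEq α] {k w : ℕ} (hw : 1 ≤ w)
    {F : Finset (Finset α)} (hFw : IsFamilyOfWSets w F) (hF : MoonflowerFree k F) :
    (w ≤ k → (F.card : ℝ) ≤ (2 * Real.exp 1 * ((k : ℝ) / (w : ℝ))) ^ w) ∧
      (k ≤ w → (F.card : ℝ) ≤ (2 * Real.exp 1 * ((w : ℝ) / (k : ℝ))) ^ k) ∧
      ∀ A : ℝ, (k : ℝ) ≤ A * (w : ℝ) → (F.card : ℝ) ≤ Real.exp ((A + 1) * (w : ℝ)) := by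
  have hcard := hF.card_le_one_add_div_pow_mul hFw hw
  refine ⟨fun hwk => ?_, fun hkw => ?_, fun A hkA => ?_⟩
  · exact hcard.trans (one_add_div_pow_mul_one_add_div_pow_le hw hwk)
  · rw [mul_comm] at hcard
    exact hcard.trans (one_add_div_pow_mul_one_add_div_pow_le hF.pos hkw)
  · calc (F.card : ℝ) ≤ (1 + (k : ℝ) / w) ^ w * (1 + (w : ℝ) / k) ^ k := hcard
      _ ≤ Real.exp k * Real.exp w := by
          gcongr
          · exact one_add_div_pow_le_exp ((neg_nonpos.2 k.cast_nonneg).trans w.cast_nonneg)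
          · exact one_add_div_pow_le_exp ((neg_nonpos.2 w.cast_nonneg).trans k.cast_nonneg)
      _ = Real.exp (k + w) := (Real.exp_add _ _).symm
      _ ≤ Real.exp ((A + 1) * w) := Real.exp_le_exp.2 (by linarith)

theorem theorem1p3 :
    (∃ C : ℝ, 0 < C ∧
      ∀ (α : Type u) [DecidableEq α] (k w : ℕ), 1 ≤ k → 1 ≤ w →
        ∀ F : Finset (Finset α), IsFamilyOfWSets w F → MoonflowerFree k F →
          (w ≤ k → (F.card : ℝ) ≤ (C * ((k : ℝ) / (w : ℝ))) ^ w) ∧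
          (k ≤ w → (F.card : ℝ) ≤ (C * ((w : ℝ) / (k : ℝ))) ^ k)) ∧
    (∀ A : ℝ, 0 < A → ∃ c : ℝ, 0 < c ∧
      ∀ (α : Type u) [DecidableEq α] (k w : ℕ), 1 ≤ k → 1 ≤ w →
        (w : ℝ) ≤ A * (k : ℝ) → (k : ℝ) ≤ A * (w : ℝ) →
        ∀ F : Finset (Finset α), IsFamilyOfWSets w F → MoonflowerFree k F →
          (F.card : ℝ) ≤ Real.exp (c * (w : ℝ))) :=
  ⟨⟨2 * Real.exp 1, by positivity, fun _ _ _ _ _ hw _ hFw hF =>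
      (theorem1p3_general hw hFw hF).imp_right And.left⟩,
    fun A hA => ⟨A + 1, by positivity, fun _ _ _ _ _ hw _ hkA _ hFw hF =>
      (theorem1p3_general hw hFw hF).2.2 A hkA⟩⟩
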